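/- There are a single random access machine program $P$ and constants $c, C \in \mathbb{N}$ such that, for every $n \ge 0$ and every simple undirected graph $G$ on $n$ vertices, given by its $n \times n$ adjacency matrix (and $n$), the program $P$ computes the chromatic number $\chi(G)$ in at most $C \cdot \bigl(\tfrac43 + \tfrac{3^{4/3}}{4}\bigr)^n$ steps, using, besides a constant number of registers, a memory of at most $C \cdot 2^n$ cells. That is, the chromatic number of an $n$-vertex graph can be computed in time $O\bigl((\tfrac43 + \tfrac{3^{4/3}}{4})^n\bigr)$ and space $O(2^n)$; here $\tfrac43 + \tfrac{3^{4/3}}{4} \approx 2.4150$. The machine is the usual RAM: registers and memory cells hold nonnegative integers of $n + c$ bits (the program never produces a larger number), and each addition, truncated subtraction, multiplication, integer division, loading of a constant, comparison with conditional jump, and indexed memory read or write on such integers takes one step. Space is counted in memory cells, including those that hold the input. -/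

import Mathlib

namespace RAM

/-- The arithmetic operations of the machine. -/
inductive Op where
  | add
  | sub
  | mul
  | div

/-- The value of an operation: sum, truncated difference, product, integer quotient.
Division by zero is an error. -/
def Op.eval : Op → ℕ → ℕ → Option ℕ
  | .add, x, y => some (x + y)
  | .sub, x, y => some (x - y)
  | .mul, x, y => some (x * y)
  | .div, x, y => if y = 0 then none else some (x / y)

/-- The instructions of the machine. Registers are named by natural numbers that are fixed in the
program text (so a program uses only finitely many of them); memory cells are reached only by
indexing with the content of a register.
* `const i v`: put the number `v` into register `i`;
* `arith o i j k`: apply `o` to the contents of registers `j` and `k`, result into register `i`;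
* `load i j`: copy into register `i` the memory cell whose address is in register `j`;
* `store i j`: copy register `j` into the memory cell whose address is in register `i`;
* `jlt i j l`, `jeq i j l`: go to instruction `l` if the content of register `i` is less than
  (equal to) that of register `j`, and otherwise to the next instruction. -/
inductive Instr where
  | const (i v : ℕ)
  | arith (o : Op) (i j k : ℕ)
  | load (i j : ℕ)
  | store (i j : ℕ)
  | jlt (i j l : ℕ)
  | jeq (i j l : ℕ)

/-- A program is a finite list of instructions, numbered from `0`. -/
abbrev Program := List Instr

/-- A configuration: program counter, registers, memory. -/
structure Config where
  pc : ℕ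
  reg : ℕ → ℕ
  mem : ℕ → ℕ

/-- Put the number `v` into register `i` and go on to the next instruction; this is an error if `v`
does not fit into a word of `w` bits. -/
def Config.setReg (w : ℕ) (c : Config) (i v : ℕ) : Option Config :=
  if v < 2 ^ w then some { c with pc := c.pc + 1, reg := Function.update c.reg i v } else none

/-- Go to instruction `l` if `b` holds, and to the next instruction otherwise. -/
def Config.jump (c : Config) (b : Bool) (l : ℕ) : Config :=
  { c with pc := if b then l else c.pc + 1 }

/-- Effect of one instruction on a machine with words of `w` bits and a memory of `s` words
(cells `0, …, s - 1`). Results that do not fit into a word, division by zero, and accesses to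
cells outside of the memory are errors (`none`). -/
def exec (w s : ℕ) (c : Config) : Instr → Option Config
  | .const i v => c.setReg w i v
  | .arith o i j k => (o.eval (c.reg j) (c.reg k)).bind (c.setReg w i)
  | .load i j => if c.reg j < s then c.setReg w i (c.mem (c.reg j)) else none
  | .store i j =>
      if c.reg i < s then
        some { c with pc := c.pc + 1, mem := Function.update c.mem (c.reg i) (c.reg j) }
      else none
  | .jlt i j l => some (c.jump (decide (c.reg i < c.reg j)) l)
  | .jeq i j l => some (c.jump (decide (c.reg i = c.reg j)) l)

/-- One step of program `P`: execute the instruction at the program counter. -/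
def step (P : Program) (w s : ℕ) (c : Config) : Option Config :=
  (P[c.pc]?).bind (exec w s c)

/-- `Steps P w s t c c'`: on a machine with words of `w` bits and a memory of `s` words, program
`P` gets from `c` to `c'` by executing exactly `t` instructions, all without error. -/
inductive Steps (P : Program) (w s : ℕ) : ℕ → Config → Config → Prop where
  | zero (c : Config) : Steps P w s 0 c c
  | succ {t : ℕ} {c c' c'' : Config} :
      step P w s c = some c' → Steps P w s t c' c'' → Steps P w s (t + 1) c c''

/-- The machine has halted normally when the program counter has left the program. -/
def Halted (P : Program) (c : Config) : Prop :=
  P.length ≤ c.pc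

open Classical in
/-- The initial configuration for an `n`-vertex graph: register `0` holds `n`, the first `n * n`
memory cells hold the adjacency matrix row by row, and all else is `0`. -/
noncomputable def init {n : ℕ} (G : SimpleGraph (Fin n)) : Config where
  pc := 0
  reg := fun r => if r = 0 then n else 0
  mem := fun a => if ∃ i j : Fin n, a = n * (i : ℕ) + (j : ℕ) ∧ G.Adj i j then 1 else 0

end RAM

/-! ### Structured programs and their machine code. -/

namespace RAM

/-! The algorithm is inclusion–exclusion over vertex sets. If `i(A)` counts the independent subsets
of `A`, then `i(A)^k` counts the `k`-tuples of independent sets with union inside `A`, so the sum of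
`(-1)^|A| i(A)^k` over all `A` is, up to sign, the number of `k`-tuples of independent sets covering
all vertices (`sum_indepCount_pow`). This number is nonzero exactly when the graph is `k`-colorable
(`covers_nonempty_iff`).

All `i(A)` are tabulated by the recursion that removes the largest vertex (`indepCount_insert`);
with `A` coded by a binary number, each entry depends only on earlier ones. The table takes two
cells per set, for `i(A)` and the parity of `|A|`.

The number of covers can have about `n^2` bits, too many for a word of `n + 10` bits. Hence it is
only computed modulo each `m` with `2 ≤ m < 2n^2 + 10`. A number of at most `2^(n^2)` divisible by
all of these is divisible by a central binomial coefficient that exceeds it, so it is zero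
(`eq_zero_of_forall_dvd`). The chromatic number is the count of `k < n` for which all residues
vanish (`coverCount_eq`).

The total time is `O(n^4 2^n)`, which is below the claimed bound because its base exceeds `2.4 > 2`.
Correctness of the machine code is derived from a program logic with time bounds (`Ends`, `wp`),
transferred to the machine by `Big.steps`. -/

/-- Registers and memory of the machine, without the program counter. -/
structure Store where
  reg : ℕ → ℕ
  mem : ℕ → ℕ

/-- A configuration made of a program counter and a store. -/
def Store.at (σ : Store) (l : ℕ) : Config := ⟨l, σ.reg, σ.mem⟩

/-- Structured programs: nothing, single instructions, sequences, and loops that run as long as the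
content of register `i` is less than that of register `j`. -/
inductive Cmd where
  | skip
  | instr (a : Instr)
  | seq (c d : Cmd)
  | loop (i j : ℕ) (c : Cmd)

/-- Length of the machine code of a structured program. -/
def Cmd.len : Cmd → ℕ
  | .skip => 0
  | .instr _ => 1
  | .seq c d => c.len + d.len
  | .loop _ _ c => c.len + 3

/-- Machine code of a structured program, to be placed at address `l`. -/
def Cmd.code : Cmd → ℕ → Program
  | .skip, _ => []
  | .instr a, _ => [a]
  | .seq c d, l => c.code l ++ d.code (l + c.len)
  | .loop i j c, l =>
      .jlt i j (l + 2) :: .jeq i i (l + (c.len + 3)) :: (c.code (l + 2) ++ [.jeq i i l])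

lemma Cmd.length_code (c : Cmd) (l : ℕ) : (c.code l).length = c.len := by
  induction c generalizing l <;> simp_all [Cmd.code, Cmd.len]

/-- Big-step semantics with running time; a single instruction must not be a jump. -/
inductive Big (w s : ℕ) : Cmd → ℕ → Store → Store → Prop where
  | skip {σ : Store} : Big w s .skip 0 σ σ
  | instr {a : Instr} {σ τ : Store} (h : ∀ l, exec w s (σ.at l) a = some (τ.at (l + 1))) :
      Big w s (.instr a) 1 σ τ
  | seq {c d : Cmd} {t u : ℕ} {σ τ ρ : Store} (h₁ : Big w s c t σ τ) (h₂ : Big w s d u τ ρ) :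
      Big w s (.seq c d) (t + u) σ ρ
  | done {i j : ℕ} {c : Cmd} {σ : Store} (h : ¬ σ.reg i < σ.reg j) :
      Big w s (.loop i j c) 2 σ σ
  | turn {i j : ℕ} {c : Cmd} {t u : ℕ} {σ τ ρ : Store} (h : σ.reg i < σ.reg j)
      (h₁ : Big w s c t σ τ) (h₂ : Big w s (.loop i j c) u τ ρ) :
      Big w s (.loop i j c) (1 + (t + (1 + u))) σ ρ

lemma Steps.trans {P : Program} {w s t u : ℕ} {a b c : Config} (h₁ : Steps P w s t a b)
    (h₂ : Steps P w s u b c) : Steps P w s (t + u) a c := by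
  induction h₁ with
  | zero => simpa using h₂
  | succ h _ ih => rw [Nat.add_right_comm]; exact .succ h (ih h₂)

lemma Steps.single {P : Program} {w s : ℕ} {a b : Config} (h : step P w s a = some b) :
    Steps P w s 1 a b := .succ h (.zero b)

/-- Jump targets are absolute, so the address `l` is part of the claim. `P` is arbitrary apart from
containing the code at `l`, and this passes to subprograms in the induction. -/
lemma Big.steps {w s t : ℕ} {c : Cmd} {σ τ : Store} (h : Big w s c t σ τ) (P : Program) (l : ℕ)
    (hP : ∀ k < c.len, P[l + k]? = (c.code l)[k]?) :
    Steps P w s t (σ.at l) (τ.at (l + c.len)) := by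
  induction h generalizing l with
  | skip => exact .zero _
  | @instr a σ τ h =>
    have := hP 0 (by simp [Cmd.len])
    simp only [Cmd.code, add_zero, List.getElem?_cons_zero] at this
    refine Steps.single ?_
    simp only [step, Store.at] at this ⊢
    rw [this]
    exact h l
  | @seq c d t u σ τ ρ h₁ h₂ ih₁ ih₂ =>
    simp only [Cmd.len, Cmd.code] at hP ⊢
    rw [← add_assoc]
    refine (ih₁ l fun k hk => ?_).trans (ih₂ (l + c.len) fun k hk => ?_)
    · rw [hP k (by omega), List.getElem?_append_left (by rwa [Cmd.length_code])]
    · rw [add_assoc, hP _ (by omega), List.getElem?_append_right (by simp [Cmd.length_code]),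
        Cmd.length_code, Nat.add_sub_cancel_left]
  | @done i j c σ h =>
    have h0 := hP 0 (by simp [Cmd.len])
    have h1 := hP 1 (by simp [Cmd.len])
    simp only [Cmd.code, add_zero, List.getElem?_cons_zero, List.getElem?_cons_succ] at h0 h1
    refine .succ (c' := σ.at (l + 1)) ?_ (.single ?_)
    · simp [step, Store.at, h0, exec, Config.jump, h]
    · simp [step, Store.at, h1, exec, Config.jump, Cmd.len]
  | @turn i j c t u σ τ ρ h h₁ h₂ ih₁ ih₂ =>
    have h0 := hP 0 (by simp [Cmd.len])
    have h1 := hP (c.len + 2) (by simp [Cmd.len])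
    simp only [Cmd.code, add_zero, List.getElem?_cons_zero, List.getElem?_cons_succ] at h0 h1
    rw [List.getElem?_append_right (by rw [Cmd.length_code]), Cmd.length_code, Nat.sub_self,
      List.getElem?_cons_zero] at h1
    refine Steps.trans (b := σ.at (l + 2)) (.single ?_)
      (Steps.trans (ih₁ (l + 2) fun k hk => ?_) (Steps.trans (b := τ.at l) (.single ?_) (ih₂ l hP)))
    · simp [step, Store.at, h0, exec, Config.jump, h]
    · rw [show l + 2 + k = l + (k + 2) by ring, hP _ (by simp only [Cmd.len]; omega)]
      simp only [Cmd.code, List.getElem?_cons_succ]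
      rw [List.getElem?_append_left (by rwa [Cmd.length_code])]
    · rw [show l + (c.len + 2) = l + 2 + c.len by ring] at h1
      simp [step, Store.at, h1, exec, Config.jump]

/-! ### Program logic with time bounds. -/

/-- The program `c`, started in `σ`, ends after at most `t` steps in a store with property `Q`. -/
def Ends (w s : ℕ) (c : Cmd) (σ : Store) (t : ℕ) (Q : Store → Prop) : Prop :=
  ∃ u ≤ t, ∃ τ, Big w s c u σ τ ∧ Q τ

/-- Put `v` into register `i`. -/
def Store.set (σ : Store) (i v : ℕ) : Store := ⟨Function.update σ.reg i v, σ.mem⟩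

/-- Put `v` into memory cell `a`. -/
def Store.put (σ : Store) (a v : ℕ) : Store := ⟨σ.reg, Function.update σ.mem a v⟩

@[simp] lemma Store.mem_set (σ : Store) (i v : ℕ) : (σ.set i v).mem = σ.mem := rfl

@[simp] lemma Store.reg_put (σ : Store) (i v : ℕ) : (σ.put i v).reg = σ.reg := rfl

lemma Store.reg_set (σ : Store) (i v r : ℕ) :
    (σ.set i v).reg r = if r = i then v else σ.reg r := Function.update_apply ..

lemma Store.mem_put (σ : Store) (a v b : ℕ) :
    (σ.put a v).mem b = if b = a then v else σ.mem b := Function.update_apply ..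

/-- Weakest precondition of a list of instructions other than jumps. -/
def wp (w s : ℕ) : List Instr → Store → (Store → Prop) → Prop
  | [], σ, Q => Q σ
  | .const i v :: l, σ, Q => v < 2 ^ w ∧ wp w s l (σ.set i v) Q
  | .arith .add i j k :: l, σ, Q =>
      σ.reg j + σ.reg k < 2 ^ w ∧ wp w s l (σ.set i (σ.reg j + σ.reg k)) Q
  | .arith .sub i j k :: l, σ, Q =>
      σ.reg j - σ.reg k < 2 ^ w ∧ wp w s l (σ.set i (σ.reg j - σ.reg k)) Q
  | .arith .mul i j k :: l, σ, Q =>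
      σ.reg j * σ.reg k < 2 ^ w ∧ wp w s l (σ.set i (σ.reg j * σ.reg k)) Q
  | .arith .div i j k :: l, σ, Q =>
      σ.reg k ≠ 0 ∧ σ.reg j / σ.reg k < 2 ^ w ∧ wp w s l (σ.set i (σ.reg j / σ.reg k)) Q
  | .load i j :: l, σ, Q =>
      σ.reg j < s ∧ σ.mem (σ.reg j) < 2 ^ w ∧ wp w s l (σ.set i (σ.mem (σ.reg j))) Q
  | .store i j :: l, σ, Q => σ.reg i < s ∧ wp w s l (σ.put (σ.reg i) (σ.reg j)) Q
  | .jlt .. :: _, _, _ => False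
  | .jeq .. :: _, _, _ => False

/-- A list of instructions. -/
def Cmd.block : List Instr → Cmd
  | [] => .skip
  | a :: l => .seq (.instr a) (.block l)

variable {w s : ℕ}

lemma Ends.mono {c : Cmd} {σ : Store} {t u : ℕ} {Q R : Store → Prop} (h : Ends w s c σ t Q)
    (htu : t ≤ u) (hQR : ∀ τ, Q τ → R τ) : Ends w s c σ u R := by
  obtain ⟨v, hv, τ, h, hQ⟩ := h
  exact ⟨v, hv.trans htu, τ, h, hQR τ hQ⟩

lemma Ends.seq {c d : Cmd} {σ : Store} {t u : ℕ} {Q R : Store → Prop} (h₁ : Ends w s c σ t Q)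
    (h₂ : ∀ τ, Q τ → Ends w s d τ u R) : Ends w s (.seq c d) σ (t + u) R := by
  obtain ⟨t', ht, τ, h, hQ⟩ := h₁
  obtain ⟨u', hu, ρ, h', hR⟩ := h₂ τ hQ
  exact ⟨_, add_le_add ht hu, ρ, h.seq h', hR⟩

/-- The new store is the same for every address `k`: jumps have precondition `False`, and the other
instructions only advance the program counter by one. -/
lemma exists_exec_of_wp {a : Instr} {l : List Instr} {σ : Store} {Q : Store → Prop}
    (h : wp w s (a :: l) σ Q) :
    ∃ τ, (∀ k, exec w s (σ.at k) a = some (τ.at (k + 1))) ∧ wp w s l τ Q := by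
  rcases a with ⟨i, v⟩ | ⟨_ | _ | _ | _, i, j, k⟩ | ⟨i, j⟩ | ⟨i, j⟩ | ⟨i, j, k⟩ | ⟨i, j, k⟩
  · exact ⟨_, fun _ => by simp [exec, Config.setReg, h.1, Store.at, Store.set], h.2⟩
  · exact ⟨_, fun _ => by
      simpa [exec, Config.setReg, Op.eval, Store.at, Store.set] using h.1, h.2⟩
  · exact ⟨_, fun _ => by
      simpa [exec, Config.setReg, Op.eval, Store.at, Store.set] using h.1, h.2⟩
  · exact ⟨_, fun _ => by
      simpa [exec, Config.setReg, Op.eval, Store.at, Store.set] using h.1, h.2⟩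
  · exact ⟨_, fun _ => by
      simpa [exec, Config.setReg, Op.eval, Store.at, Store.set, h.1] using h.2.1, h.2.2⟩
  · exact ⟨_, fun _ => by simp [exec, Config.setReg, Store.at, Store.set, h.1, h.2.1], h.2.2⟩
  · exact ⟨_, fun _ => by simp [exec, Store.at, Store.put, h.1], h.2⟩
  · exact h.elim
  · exact h.elim

lemma Ends.block {l : List Instr} {σ : Store} {R : Store → Prop} (h : wp w s l σ R) :
    Ends w s (.block l) σ l.length R := by
  induction l generalizing σ with
  | nil => exact ⟨0, le_rfl, σ, .skip, h⟩
  | cons a l ih =>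
    obtain ⟨τ, h₁, h₂⟩ := exists_exec_of_wp h
    rw [List.length_cons, add_comm]
    exact Ends.seq (Q := (· = τ)) ⟨1, le_rfl, τ, .instr h₁, rfl⟩ fun _ h => h ▸ ih h₂

/-- A loop whose counter, register `i`, runs from `x` to `z`. -/
lemma Ends.loop {i j : ℕ} {c : Cmd} {σ : Store} {t x z : ℕ} (I : ℕ → Store → Prop)
    (hI : ∀ y τ, I y τ → τ.reg i = y ∧ τ.reg j = z)
    (hc : ∀ y τ, x ≤ y → y < z → I y τ → Ends w s c τ t (I (y + 1)))
    (hxz : x ≤ z) (h : I x σ) : Ends w s (.loop i j c) σ ((z - x) * (t + 2) + 2) (I z) := by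
  obtain ⟨d, rfl⟩ := Nat.exists_eq_add_of_le hxz
  induction d generalizing x σ with
  | zero =>
    obtain ⟨h1, h2⟩ := hI _ _ h
    exact ⟨2, by simp, σ, .done (by omega), h⟩
  | succ d ih =>
    obtain ⟨h1, h2⟩ := hI _ _ h
    obtain ⟨u, hu, τ, hb, hτ⟩ := hc x σ le_rfl (by omega) h
    obtain ⟨u', hu', ρ, hb', hρ⟩ := ih (x := x + 1) (σ := τ) hτ
      (by intro y τ hy; simpa [add_assoc, add_comm, add_left_comm] using hI y τ hy)
      (fun y τ h1 h2 h3 => hc y τ (by omega) (by omega) h3) (by omega)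
    refine ⟨_, ?_, ρ, .turn (by omega) hb hb', ?_⟩
    · rw [Nat.add_sub_cancel_left] at hu' ⊢
      rw [add_mul]; omega
    · simpa [add_assoc, add_comm, add_left_comm] using hρ

end RAM

/-! ### Building the table of independent set counts. -/

namespace RAM

/-- The elements `l < u` of the set coded by `S` with `a l = 0`, again as a code. -/
def mask (a : ℕ → ℕ) (S u : ℕ) : ℕ := ∑ l ∈ Finset.range u, S / 2 ^ l % 2 * (1 - a l) * 2 ^ l

lemma mask_succ (a : ℕ → ℕ) (S u : ℕ) :
    mask a S (u + 1) = mask a S u + S / 2 ^ u % 2 * (1 - a u) * 2 ^ u := Finset.sum_range_succ ..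

lemma mask_digit_le (a : ℕ → ℕ) (S u : ℕ) : S / 2 ^ u % 2 * (1 - a u) * 2 ^ u ≤ 2 ^ u := by
  have h1 : S / 2 ^ u % 2 ≤ 1 := by omega
  have h2 : 1 - a u ≤ 1 := by omega
  simpa using Nat.mul_le_mul_right (2 ^ u) (Nat.mul_le_mul h1 h2)

/-- With `u = v` this shows that the recursion for `2 ^ v + S` reads an entry that is already in the
table. -/
lemma mask_lt (a : ℕ → ℕ) (S u : ℕ) : mask a S u < 2 ^ u := by
  induction u with
  | zero => simp [mask]
  | succ u ih =>
    have := mask_digit_le a S u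
    rw [mask_succ, pow_succ]; omega

/-- Computes in register `9` the mask of the set in register `8` by the row of the matrix that
starts at the address in register `6`. -/
def maskCmd : Cmd := .loop 11 5 <| .block
  [.arith .div 12 8 2, .arith .mul 13 12 2, .arith .sub 13 8 13, .arith .div 8 8 2,
   .arith .add 14 6 11, .load 14 14, .arith .sub 14 1 14, .arith .mul 13 13 14,
   .arith .mul 13 13 10, .arith .add 9 9 13, .arith .add 10 10 10, .arith .add 11 11 1]

/-- Computes the entries of the table for the set `2 ^ v + S`. -/
def entryCmd : Cmd := .seq (.block [.const 9 0, .const 10 1, .const 11 0, .arith .add 8 7 9]) <|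
  .seq maskCmd <| .block
  [.arith .add 9 9 9, .arith .add 9 9 3, .load 9 9, .arith .add 10 7 7, .arith .add 10 10 3,
   .load 12 10, .arith .add 9 9 12, .arith .add 10 10 1, .load 13 10, .arith .sub 13 1 13,
   .arith .add 10 4 7, .arith .add 10 10 10, .arith .add 10 10 3, .store 10 9,
   .arith .add 10 10 1, .store 10 13, .arith .add 7 7 1]

/-- Computes the entries of the table for the sets with largest element `v`. -/
def levelCmd : Cmd := .seq (.block [.arith .mul 6 0 5, .const 7 0]) <|
  .seq (.loop 7 4 entryCmd) <| .block [.arith .add 4 4 4, .arith .add 5 5 1]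

/-- Computes the table. -/
def tableCmd : Cmd := .seq (.block
  [.const 1 1, .const 2 2, .arith .mul 3 0 0, .const 4 1, .const 5 0, .store 3 1,
   .arith .add 6 3 1, .const 7 0, .store 6 7]) <| .loop 5 0 levelCmd

/-- The memory holds the `n × n` matrix `a`, and behind it the values of `I` and `q`, in turn, at
the numbers below `L`. -/
structure Table (n : ℕ) (a : ℕ → ℕ → ℕ) (I q : ℕ → ℕ) (L : ℕ) (m : ℕ → ℕ) : Prop where
  matrix : ∀ i < n, ∀ j < n, m (n * i + j) = a i j
  fst : ∀ S < L, m (n * n + 2 * S) = I S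
  snd : ∀ S < L, m (n * n + 2 * S + 1) = q S

/-- The constants that the program keeps in its first registers. -/
structure Consts (n : ℕ) (r : ℕ → ℕ) : Prop where
  zero : r 0 = n
  one : r 1 = 1
  two : r 2 = 2
  three : r 3 = n * n

variable {w s n : ℕ} {a : ℕ → ℕ → ℕ} {I q : ℕ → ℕ}

lemma Consts.of_eq {r r' : ℕ → ℕ} (h : Consts n r) (h' : ∀ i < 4, r' i = r i) : Consts n r' :=
  ⟨by rw [h' 0 (by omega), h.zero], by rw [h' 1 (by omega), h.one],
    by rw [h' 2 (by omega), h.two], by rw [h' 3 (by omega), h.three]⟩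

lemma mul_add_lt_mul_self {n i j : ℕ} (hi : i < n) (hj : j < n) : n * i + j < n * n := by
  nlinarith

lemma ends_maskCmd {σ : Store} {v S : ℕ} (hw : n * n + 4 * 2 ^ n + 4 < 2 ^ w)
    (hs : n * n + 2 * 2 ^ n ≤ s) (hv : v < n) (hS : S < 2 ^ v) (ha : ∀ i j, a i j ≤ 1)
    (hc : Consts n σ.reg) {L : ℕ} (hT : Table n a I q L σ.mem) (h5 : σ.reg 5 = v)
    (h6 : σ.reg 6 = n * v) (h8 : σ.reg 8 = S) (h9 : σ.reg 9 = 0) (h10 : σ.reg 10 = 1)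
    (h11 : σ.reg 11 = 0) :
    Ends w s maskCmd σ (n * 14 + 2) fun τ =>
      τ.mem = σ.mem ∧ (∀ r < 8, τ.reg r = σ.reg r) ∧ τ.reg 9 = mask (a v) S v := by
  -- Invariant after `u` turns: the unread binary digits of `S` are in register `8`, the partial
  -- mask in `9`, the current place value in `10`.
  have key := Ends.loop (w := w) (s := s) (i := 11) (j := 5) (σ := σ) (t := 12) (x := 0) (z := v)
    (c := .block
      [.arith .div 12 8 2, .arith .mul 13 12 2, .arith .sub 13 8 13, .arith .div 8 8 2,
       .arith .add 14 6 11, .load 14 14, .arith .sub 14 1 14, .arith .mul 13 13 14,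
       .arith .mul 13 13 10, .arith .add 9 9 13, .arith .add 10 10 10, .arith .add 11 11 1])
    (fun u τ => τ.mem = σ.mem ∧ (∀ r < 8, τ.reg r = σ.reg r) ∧ τ.reg 8 = S / 2 ^ u ∧
      τ.reg 9 = mask (a v) S u ∧ τ.reg 10 = 2 ^ u ∧ τ.reg 11 = u)
    (fun u τ ⟨_, h, _, _, _, h'⟩ => ⟨h', by rw [h 5 (by omega), h5]⟩)
    (fun u τ _ hu ⟨hm, hr, g8, g9, g10, g11⟩ => ?_) (Nat.zero_le _)
    ⟨rfl, fun _ _ => rfl, by simpa using h8, by simpa [mask] using h9, by simpa using h10, h11⟩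
  · refine key.mono (by gcongr; omega) fun τ h => ⟨h.1, h.2.1, h.2.2.2.1⟩
  · have k1 : τ.reg 1 = 1 := by rw [hr 1 (by omega), hc.one]
    have k2 : τ.reg 2 = 2 := by rw [hr 2 (by omega), hc.two]
    have k6 : τ.reg 6 = n * v := by rw [hr 6 (by omega), h6]
    have km := hT.matrix v hv u (by omega)
    have hadr : n * v + u < n * n := mul_add_lt_mul_self hv (by omega)
    have hlow : 2 ^ v ≤ 2 ^ n := Nat.pow_le_pow_right (by norm_num) hv.le
    have hlow' : 2 ^ u ≤ 2 ^ n := Nat.pow_le_pow_right (by norm_num) (by omega)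
    have hmask := mask_lt (a v) S u
    have hd := mask_digit_le (a v) S u
    have hx : S / 2 ^ u ≤ S := Nat.div_le_self _ _
    have hb : S / 2 ^ u - S / 2 ^ u / 2 * 2 = S / 2 ^ u % 2 := by omega
    have hb' : S / 2 ^ u % 2 * (1 - a v u) ≤ 1 :=
      Nat.mul_le_mul (show S / 2 ^ u % 2 ≤ 1 by omega) (show 1 - a v u ≤ 1 by omega)
    have hau := ha v u
    refine (Ends.block ?_)
    simp only [wp, Store.reg_set, Store.mem_set, hm, k1, k2, k6, km, g8, g9, g10, g11, reduceIte,
      Nat.reduceEqDiff, hb, Nat.succ_ne_self, OfNat.ofNat_ne_zero, OfNat.one_ne_ofNat, ne_eq,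
      not_false_eq_true, true_and, and_true]
    generalize 2 ^ w = W at *
    refine ⟨by omega, by omega, by omega, by omega, by omega, by omega, by omega, by omega,
      by omega, by omega, by omega, by omega, by omega, ?_, ?_, ?_, ?_⟩
    · intro r hr'
      rw [← hr r hr']
      simp [show r ≠ 11 by omega, show r ≠ 10 by omega, show r ≠ 9 by omega,
        show r ≠ 14 by omega, show r ≠ 8 by omega, show r ≠ 13 by omega, show r ≠ 12 by omega]
    · rw [Nat.div_div_eq_div_mul, pow_succ]
    · rw [mask_succ]
    · ring

/-- What the two functions in the table satisfy. -/
structure TableSpec (n : ℕ) (a : ℕ → ℕ → ℕ) (I q : ℕ → ℕ) : Prop where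
  matrix_le : ∀ i j, a i j ≤ 1
  fst_zero : I 0 = 1
  fst_add : ∀ v < n, ∀ S < 2 ^ v, I (2 ^ v + S) = I S + I (mask (a v) S v)
  fst_le : ∀ S < 2 ^ n, I S ≤ 2 ^ n
  snd_zero : q 0 = 0
  snd_add : ∀ v < n, ∀ S < 2 ^ v, q (2 ^ v + S) = 1 - q S
  snd_le : ∀ S, q S ≤ 1

/-- The matrix and the earlier entries all lie below address `n * n + 2 * L`, so writing the new
pair does not disturb them. -/
lemma Table.succ {L : ℕ} {m m' : ℕ → ℕ} (h : Table n a I q L m) (h₁ : m' (n * n + 2 * L) = I L)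
    (h₂ : m' (n * n + 2 * L + 1) = q L) (h' : ∀ b < n * n + 2 * L, m' b = m b) :
    Table n a I q (L + 1) m' := by
  refine ⟨fun i hi j hj => ?_, fun S hS => ?_, fun S hS => ?_⟩
  · rw [h' _ ((mul_add_lt_mul_self hi hj).trans_le (Nat.le_add_right _ _)), h.matrix i hi j hj]
  · rcases Nat.lt_succ_iff_lt_or_eq.1 hS with hS | rfl
    · rw [h' _ (by omega), h.fst S hS]
    · exact h₁
  · rcases Nat.lt_succ_iff_lt_or_eq.1 hS with hS | rfl
    · rw [h' _ (by omega), h.snd S hS]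
    · exact h₂

lemma ends_entryCmd {σ : Store} {v S : ℕ} (hw : n * n + 4 * 2 ^ n + 4 < 2 ^ w)
    (hs : n * n + 2 * 2 ^ n ≤ s) (hv : v < n) (hS : S < 2 ^ v) (hI : TableSpec n a I q)
    (hc : Consts n σ.reg) (hT : Table n a I q (2 ^ v + S) σ.mem) (h4 : σ.reg 4 = 2 ^ v)
    (h5 : σ.reg 5 = v) (h6 : σ.reg 6 = n * v) (h7 : σ.reg 7 = S) :
    Ends w s entryCmd σ (14 * n + 23) fun τ => Table n a I q (2 ^ v + S + 1) τ.mem ∧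
      (∀ r < 7, τ.reg r = σ.reg r) ∧ τ.reg 7 = S + 1 := by
  have hpow : 2 * 2 ^ v ≤ 2 ^ n := by
    rw [← pow_succ']; exact Nat.pow_le_pow_right (by norm_num) hv
  rw [show 14 * n + 23 = 4 + ((n * 14 + 2) + 17) by ring]
  refine Ends.seq (Q := fun τ => τ.mem = σ.mem ∧ (∀ r < 8, τ.reg r = σ.reg r) ∧ τ.reg 8 = S ∧
    τ.reg 9 = 0 ∧ τ.reg 10 = 1 ∧ τ.reg 11 = 0) (Ends.block ?_) ?_
  · simp only [wp, Store.reg_set, Store.mem_set, h7, reduceIte, Nat.reduceEqDiff,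
      and_true, true_and, add_zero]
    generalize 2 ^ w = W at *
    refine ⟨by omega, by omega, by omega, by omega, fun r hr => ?_⟩
    simp [show r ≠ 11 by omega, show r ≠ 10 by omega, show r ≠ 9 by omega, show r ≠ 8 by omega]
  rintro τ ⟨hm, hr, g8, g9, g10, g11⟩
  refine Ends.seq (ends_maskCmd hw hs hv hS hI.matrix_le (hc.of_eq fun i hi => hr i (by omega))
    (hm ▸ hT) (by rw [hr 5 (by omega), h5]) (by rw [hr 6 (by omega), h6]) g8 g9 g10 g11) ?_
  rintro ρ ⟨hm', hr', g9'⟩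
  have hr : ∀ r < 8, ρ.reg r = σ.reg r := fun r h => (hr' r h).trans (hr r h)
  have k1 : ρ.reg 1 = 1 := by rw [hr 1 (by omega), hc.one]
  have k3 : ρ.reg 3 = n * n := by rw [hr 3 (by omega), hc.three]
  have k4 : ρ.reg 4 = 2 ^ v := by rw [hr 4 (by omega), h4]
  have k7 : ρ.reg 7 = S := by rw [hr 7 (by omega), h7]
  have hmask := mask_lt (a v) S v
  have e1 := hT.fst (mask (a v) S v) (by omega)
  have e2 := hT.fst S (by omega)
  have e3 := hT.snd S (by omega)
  have i1 := hI.fst_le (mask (a v) S v) (by omega)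
  have i2 := hI.fst_le S (by omega)
  have i3 := hI.snd_le S
  have f1 := hI.fst_add v hv S hS
  have f2 := hI.snd_add v hv S hS
  refine Ends.block ?_
  simp only [wp, Store.reg_set, Store.mem_set, Store.reg_put, hm', hm, k1, k3, k4, k7, g9',
    reduceIte, Nat.reduceEqDiff, OfNat.one_ne_ofNat, and_true, ← two_mul, add_comm _ (n * n), e1, e2, e3]
  generalize mask (a v) S v = T at *
  generalize 2 ^ v = V at *
  generalize 2 ^ w = W at *
  refine ⟨by omega, by omega, by omega, by omega, by omega, by omega, by omega, by omega,
    by omega, by omega, by omega, by omega, by omega, by omega, by omega, by omega, by omega,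
    by omega, by omega, by omega, hT.succ ?_ ?_ ?_, ?_⟩
  · simp [Store.mem_put]
    omega
  · simp [Store.mem_put]
    omega
  · intro b hb
    simp [Store.mem_put, show b ≠ n * n + 2 * (V + S) by omega,
      show b ≠ n * n + 2 * (V + S) + 1 by omega, hm, hm']
  · intro r hr'
    rw [← hr r (by omega)]
    simp [show r ≠ 7 by omega, show r ≠ 10 by omega, show r ≠ 13 by omega,
      show r ≠ 9 by omega, show r ≠ 12 by omega]

/-- The sets with largest element `v` are the numbers `2 ^ v + S` with `S < 2 ^ v`, so each level
doubles the filled part of the table. -/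
lemma ends_levelCmd {σ : Store} {v : ℕ} (hw : n * n + 4 * 2 ^ n + 4 < 2 ^ w)
    (hs : n * n + 2 * 2 ^ n ≤ s) (hv : v < n) (hI : TableSpec n a I q)
    (hc : Consts n σ.reg) (hT : Table n a I q (2 ^ v) σ.mem) (h4 : σ.reg 4 = 2 ^ v)
    (h5 : σ.reg 5 = v) :
    Ends w s levelCmd σ (2 ^ n * (14 * n + 25) + 6) fun τ => Table n a I q (2 ^ (v + 1)) τ.mem ∧
      Consts n τ.reg ∧ τ.reg 4 = 2 ^ (v + 1) ∧ τ.reg 5 = v + 1 := by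
  have hpow : 2 * 2 ^ v ≤ 2 ^ n := by
    rw [← pow_succ']; exact Nat.pow_le_pow_right (by norm_num) hv
  have hnv : n * v ≤ n * n := Nat.mul_le_mul_left n hv.le
  rw [show 2 ^ n * (14 * n + 25) + 6 = 2 + ((2 ^ n * (14 * n + 25) + 2) + 2) by ring]
  refine Ends.seq (Q := fun τ => τ.mem = σ.mem ∧ (∀ r < 6, τ.reg r = σ.reg r) ∧ τ.reg 6 = n * v ∧
    τ.reg 7 = 0) (Ends.block ?_) ?_
  · simp only [wp, Store.reg_set, Store.mem_set, h5, hc.zero, reduceIte, Nat.reduceEqDiff,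
      and_true, true_and]
    generalize 2 ^ w = W at *
    refine ⟨by omega, by omega, fun r hr => ?_⟩
    simp [show r ≠ 6 by omega, show r ≠ 7 by omega]
  rintro τ ⟨hm, hr, g6, g7⟩
  refine Ends.seq (Q := fun ρ => Table n a I q (2 ^ v + 2 ^ v) ρ.mem ∧
    (∀ r < 7, ρ.reg r = τ.reg r) ∧ ρ.reg 7 = 2 ^ v) ((Ends.loop (x := 0) (z := 2 ^ v)
    (fun S ρ => Table n a I q (2 ^ v + S) ρ.mem ∧ (∀ r < 7, ρ.reg r = τ.reg r) ∧ ρ.reg 7 = S)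
    (fun S ρ h => ⟨h.2.2, by rw [h.2.1 4 (by omega), hr 4 (by omega), h4]⟩)
    (fun S ρ _ hS h => ?_) (Nat.zero_le _) ⟨hm ▸ hT, fun _ _ => rfl, g7⟩).mono
      (t := (2 ^ v - 0) * (14 * n + 23 + 2) + 2) ?_ fun _ h => h) fun ρ ⟨hT', hr', g7'⟩ => ?_
  · refine (ends_entryCmd hw hs hv hS hI (hc.of_eq fun r hr' => ?_) h.1 ?_ ?_ ?_ h.2.2).mono le_rfl
      fun π hπ => ⟨hπ.1, fun r h' => (hπ.2.1 r h').trans (h.2.1 r h'), hπ.2.2⟩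
    · rw [h.2.1 r (by omega), hr r (by omega)]
    · rw [h.2.1 4 (by omega), hr 4 (by omega), h4]
    · rw [h.2.1 5 (by omega), hr 5 (by omega), h5]
    · rw [h.2.1 6 (by omega), g6]
  · rw [Nat.sub_zero]
    gcongr
    norm_num
  · have hr : ∀ r < 6, ρ.reg r = σ.reg r := fun r h => (hr' r (by omega)).trans (hr r h)
    refine Ends.block ?_
    simp only [wp, Store.reg_set, Store.mem_set, hr 1 (by omega), hr 4 (by omega),
      hr 5 (by omega), hc.one, h4, h5, reduceIte, Nat.reduceEqDiff, OfNat.one_ne_ofNat,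
      and_true, ← two_mul, pow_succ']
    have := hv.trans n.lt_two_pow_self
    rw [← two_mul] at hT'
    generalize 2 ^ w = W at *
    refine ⟨by omega, by omega, hT', hc.of_eq fun r h => ?_⟩
    rw [← hr r (by omega)]
    simp [Store.reg_set, show r ≠ 4 by omega, show r ≠ 5 by omega]

lemma ends_tableCmd {σ : Store} (hw : n * n + 4 * 2 ^ n + 4 < 2 ^ w)
    (hs : n * n + 2 * 2 ^ n ≤ s) (hI : TableSpec n a I q) (h0 : σ.reg 0 = n)
    (hm : ∀ i < n, ∀ j < n, σ.mem (n * i + j) = a i j) :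
    Ends w s tableCmd σ (9 + (n * (2 ^ n * (14 * n + 25) + 6 + 2) + 2)) fun τ =>
      Table n a I q (2 ^ n) τ.mem ∧ Consts n τ.reg ∧ τ.reg 4 = 2 ^ n := by
  have hpow := Nat.one_le_two_pow (n := n)
  refine Ends.seq (Q := fun τ => Table n a I q 1 τ.mem ∧ Consts n τ.reg ∧ τ.reg 4 = 1 ∧
    τ.reg 5 = 0) (Ends.block ?_) fun τ hτ => ?_
  · have hT : Table n a I q 0 σ.mem := ⟨hm, by simp, by simp⟩
    simp only [wp, Store.reg_set, Store.reg_put, h0, reduceIte, Nat.reduceEqDiff,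
      OfNat.one_ne_ofNat, OfNat.ofNat_ne_one, OfNat.zero_ne_ofNat, zero_ne_one, and_true]
    generalize 2 ^ w = W at *
    refine ⟨by omega, by omega, by omega, by omega, by omega, by omega, by omega, by omega,
      by omega, hT.succ ?_ ?_ ?_, by simp [Store.reg_set, h0], by simp [Store.reg_set],
      by simp [Store.reg_set], by simp [Store.reg_set]⟩
    · simp [Store.mem_put, hI.fst_zero]
    · simp [Store.mem_put, hI.snd_zero]
    · intro b hb
      simp [Store.mem_put, show b ≠ n * n by omega, show b ≠ n * n + 1 by omega]
  · refine (Ends.loop (x := 0) (z := n) (fun v ρ => Table n a I q (2 ^ v) ρ.mem ∧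
      Consts n ρ.reg ∧ ρ.reg 4 = 2 ^ v ∧ ρ.reg 5 = v) (fun v ρ h => ⟨h.2.2.2, h.2.1.zero⟩)
      (fun v ρ _ hv h => ends_levelCmd hw hs hv hI h.2.1 h.1 h.2.2.1 h.2.2.2) (Nat.zero_le _)
      (by simpa using hτ)).mono le_rfl fun ρ h => ⟨h.1, h.2.1, h.2.2.1⟩

end RAM

/-! ### Evaluating the inclusion–exclusion sum modulo small numbers. -/

namespace RAM

/-- The residue modulo `m` of the sum of `± I S ^ k` over `S < N`, with the sign given by `q`. -/
def coverMod (I q : ℕ → ℕ) (N k m : ℕ) : ℕ :=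
  (∑ S ∈ Finset.range N, (1 + q S * (m - 2)) * I S ^ k) % m

/-- The sum of the residues for the moduli from `2` to `M - 1`. -/
def coverTest (I q : ℕ → ℕ) (N k M : ℕ) : ℕ := ∑ m ∈ Finset.Ico 2 M, coverMod I q N k m

/-- The number of exponents `k < l` for which all residues vanish. -/
def coverCount (I q : ℕ → ℕ) (N M l : ℕ) : ℕ := ∑ k ∈ Finset.range l, (1 - coverTest I q N k M)

/-- Multiplies register `14` by the `k`-th power of register `13`, modulo register `8`, with the
`k` of register `6`. -/
def powCmd : Cmd := .loop 15 6 <| .block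
  [.arith .mul 14 14 13, .arith .div 16 14 8, .arith .mul 16 16 8, .arith .sub 14 14 16,
   .arith .add 15 15 1]

/-- Adds the summand of `coverMod` for the `S` of register `11` to register `12`. -/
def termCmd : Cmd := .seq (.block
  [.arith .add 16 11 11, .arith .add 16 16 3, .load 13 16, .arith .add 16 16 1, .load 14 16,
   .arith .mul 14 14 10, .arith .add 14 14 1, .arith .div 16 13 8, .arith .mul 16 16 8,
   .arith .sub 13 13 16, .const 15 0]) <| .seq powCmd <| .block
  [.arith .add 12 12 14, .arith .div 16 12 8, .arith .mul 16 16 8, .arith .sub 12 12 16,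
   .arith .add 11 11 1]

/-- Adds `coverMod` for the `m` of register `8` to register `9`. -/
def modCmd : Cmd := .seq (.block [.arith .sub 10 8 2, .const 11 0, .const 12 0]) <|
  .seq (.loop 11 4 termCmd) <| .block [.arith .add 9 9 12, .arith .add 8 8 1]

/-- Increases register `7` if `coverTest` vanishes for the `k` of register `6`. -/
def testCmd : Cmd := .seq (.block [.const 8 2, .const 9 0]) <|
  .seq (.loop 8 5 modCmd) <| .block [.arith .sub 9 1 9, .arith .add 7 7 9, .arith .add 6 6 1]

/-- Computes `coverCount` from the table. -/
def countCmd : Cmd := .seq (.block [.arith .add 5 3 3, .const 6 10, .arith .add 5 5 6, .const 6 0,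
    .const 7 0]) <|
  .seq (.loop 6 0 testCmd) <| .block [.arith .sub 0 0 0, .arith .add 0 0 7]

variable {w s n : ℕ} {a : ℕ → ℕ → ℕ} {I q : ℕ → ℕ}

lemma sub_div_mul_self (x m : ℕ) : x - x / m * m = x % m := by
  rw [mul_comm]; exact (Nat.mod_def x m).symm

/-- Reducing after every multiplication keeps all products below `m * m`, which fits into a word. -/
lemma ends_powCmd {σ : Store} {k m x y : ℕ} (hm : 0 < m) (hmw : m * m < 2 ^ w) (hk : k ≤ n)
    (hn : n < 2 ^ w) (hx : x < m) (hy : y < m) (h1 : σ.reg 1 = 1) (h6 : σ.reg 6 = k)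
    (h8 : σ.reg 8 = m) (h13 : σ.reg 13 = y) (h14 : σ.reg 14 = x) (h15 : σ.reg 15 = 0) :
    Ends w s powCmd σ (7 * n + 2) fun τ =>
      τ.mem = σ.mem ∧ (∀ r < 13, τ.reg r = σ.reg r) ∧ τ.reg 14 = x * y ^ k % m := by
  refine (Ends.loop (x := 0) (z := k) (t := 5) (fun j τ => τ.mem = σ.mem ∧
    (∀ r < 14, τ.reg r = σ.reg r) ∧ τ.reg 14 = x * y ^ j % m ∧ τ.reg 15 = j)
    (fun j τ h => ⟨h.2.2.2, by rw [h.2.1 6 (by omega), h6]⟩) ?_ (Nat.zero_le _)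
    ⟨rfl, fun _ _ => rfl, by rw [h14, pow_zero, mul_one, Nat.mod_eq_of_lt hx], h15⟩).mono
    (by rw [Nat.sub_zero]; linarith) fun τ h => ⟨h.1, fun r hr => h.2.1 r (by omega), h.2.2.1⟩
  rintro j τ - hj ⟨hτ, hr, g14, g15⟩
  have hp : x * y ^ j % m < m := Nat.mod_lt _ hm
  have hpy : x * y ^ j % m * y < m * m := Nat.mul_lt_mul'' hp hy
  have h2 := Nat.div_mul_le_self (x * y ^ j % m * y) m
  have h3 := Nat.div_le_self (x * y ^ j % m * y) m
  have h4 := Nat.mod_le (x * y ^ j % m * y) m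
  refine Ends.block ?_
  simp only [wp, Store.reg_set, Store.mem_set, hr 1 (by omega), hr 8 (by omega),
    hr 13 (by omega), h1, h8, h13, g14, g15, reduceIte, Nat.reduceEqDiff, sub_div_mul_self]
  generalize 2 ^ w = W at *
  refine ⟨by omega, by omega, by omega, by omega, by omega, by omega, hτ, fun r hr' => ?_, ?_,
    trivial⟩
  · rw [← hr r hr']
    simp [show r ≠ 14 by omega, show r ≠ 15 by omega, show r ≠ 16 by omega]
  · rw [pow_succ, ← mul_assoc, Nat.mod_mul_mod]

/-- The factor `1 + q S * (m - 2)` is `1` or `m - 1`, a nonnegative representative of the sign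
modulo `m`, so no negative numbers are needed. -/
lemma ends_termCmd {σ : Store} {k m S A : ℕ} (hw : n * n + 4 * 2 ^ n + 4 < 2 ^ w)
    (hs : n * n + 2 * 2 ^ n ≤ s) (hI : TableSpec n a I q) (hm : 2 ≤ m) (hmw : m * m < 2 ^ w)
    (hk : k ≤ n) (hS : S < 2 ^ n) (hc : Consts n σ.reg) (hT : Table n a I q (2 ^ n) σ.mem)
    (h6 : σ.reg 6 = k) (h8 : σ.reg 8 = m) (h10 : σ.reg 10 = m - 2) (h11 : σ.reg 11 = S)
    (h12 : σ.reg 12 = A % m) :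
    Ends w s termCmd σ (7 * n + 18) fun τ => τ.mem = σ.mem ∧ (∀ r < 11, τ.reg r = σ.reg r) ∧
      τ.reg 11 = S + 1 ∧ τ.reg 12 = (A + (1 + q S * (m - 2)) * I S ^ k) % m := by
  rw [show 7 * n + 18 = 11 + ((7 * n + 2) + 5) by ring]
  have hmm : 2 * m ≤ m * m := Nat.mul_le_mul_right m hm
  have i0 := hI.snd_le S
  have i1 := hI.fst_le S hS
  have i2 : q S * (m - 2) ≤ m - 2 := by simpa using Nat.mul_le_mul_right (m - 2) i0
  have i3 := Nat.div_mul_le_self (I S) m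
  have i4 := Nat.div_le_self (I S) m
  have i5 := Nat.mod_le (I S) m
  refine Ends.seq (Q := fun τ => τ.mem = σ.mem ∧ (∀ r < 13, τ.reg r = σ.reg r) ∧
    τ.reg 13 = I S % m ∧ τ.reg 14 = 1 + q S * (m - 2) ∧ τ.reg 15 = 0) (Ends.block ?_) ?_
  · simp only [wp, Store.reg_set, Store.mem_set, hc.one, hc.three, h8, h10, h11, reduceIte,
      Nat.reduceEqDiff, OfNat.one_ne_ofNat, sub_div_mul_self, and_true, true_and, ← two_mul,
      add_comm _ (n * n), hT.fst S hS, add_comm _ 1]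
    rw [add_comm 1, hT.snd S hS]
    generalize 2 ^ w = W at *
    refine ⟨by omega, by omega, by omega, by omega, by omega, by omega, by omega, by omega,
      by omega, by omega, by omega, by omega, by omega, by omega, fun r hr => ?_, rfl⟩
    simp [show r ≠ 13 by omega, show r ≠ 14 by omega, show r ≠ 15 by omega, show r ≠ 16 by omega]
  rintro τ ⟨hτ, hr, g13, g14, g15⟩
  have hn : n < 2 ^ n := n.lt_two_pow_self
  refine Ends.seq (ends_powCmd (by omega) hmw hk (by omega) (by omega)
    (Nat.mod_lt _ (by omega)) (by rw [hr 1 (by omega), hc.one]) (by rw [hr 6 (by omega), h6])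
    (by rw [hr 8 (by omega), h8]) g13 g14 g15) ?_
  rintro ρ ⟨hρ, hr', g14'⟩
  have hr : ∀ r < 13, ρ.reg r = σ.reg r := fun r h => (hr' r h).trans (hr r h)
  have hA : A % m < m := Nat.mod_lt _ (by omega)
  have e : (1 + q S * (m - 2)) * (I S % m) ^ k % m = (1 + q S * (m - 2)) * I S ^ k % m :=
    Nat.ModEq.mul_left _ ((Nat.mod_modEq (I S) m).pow k)
  rw [e] at g14'
  have hB : (1 + q S * (m - 2)) * I S ^ k % m < m := Nat.mod_lt _ (by omega)
  refine Ends.block ?_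
  simp only [wp, Store.reg_set, Store.mem_set, hr 1 (by omega), hr 8 (by omega),
    hr 11 (by omega), hr 12 (by omega), hc.one, h8, h11, h12, g14', reduceIte, Nat.reduceEqDiff,
    sub_div_mul_self]
  have j1 := Nat.div_mul_le_self (A % m + (1 + q S * (m - 2)) * I S ^ k % m) m
  have j2 := Nat.div_le_self (A % m + (1 + q S * (m - 2)) * I S ^ k % m) m
  have j3 := Nat.mod_le (A % m + (1 + q S * (m - 2)) * I S ^ k % m) m
  rw [← Nat.add_mod] at *
  generalize 2 ^ w = W at *
  refine ⟨by omega, by omega, by omega, by omega, by omega, by omega, hρ.trans hτ,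
    fun r hr' => ?_, trivial, rfl⟩
  rw [← hr r (by omega)]
  simp [show r ≠ 11 by omega, show r ≠ 12 by omega, show r ≠ 16 by omega]

lemma ends_modCmd {σ : Store} {k m M : ℕ} (hw : n * n + 4 * 2 ^ n + 4 < 2 ^ w)
    (hs : n * n + 2 * 2 ^ n ≤ s) (hI : TableSpec n a I q) (hm : 2 ≤ m) (hmM : m < M)
    (hMw : M * M < 2 ^ w)
    (hk : k ≤ n) (hc : Consts n σ.reg) (hT : Table n a I q (2 ^ n) σ.mem) (h4 : σ.reg 4 = 2 ^ n)
    (h6 : σ.reg 6 = k) (h8 : σ.reg 8 = m) (h9 : σ.reg 9 = coverTest I q (2 ^ n) k m) :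
    Ends w s modCmd σ (2 ^ n * (7 * n + 20) + 7) fun τ => τ.mem = σ.mem ∧
      (∀ r < 8, τ.reg r = σ.reg r) ∧ τ.reg 8 = m + 1 ∧
      τ.reg 9 = coverTest I q (2 ^ n) k (m + 1) := by
  rw [show 2 ^ n * (7 * n + 20) + 7 = 3 + ((2 ^ n * (7 * n + 20) + 2) + 2) by ring]
  have hmw : m * m < 2 ^ w := (Nat.mul_lt_mul'' hmM hmM).trans hMw
  have hMM : M ≤ M * M := Nat.le_mul_self M
  have hsum : coverTest I q (2 ^ n) k (m + 1) =
      coverTest I q (2 ^ n) k m + coverMod I q (2 ^ n) k m := Finset.sum_Ico_succ_top hm _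
  -- The residues are added up without reduction, so that the sum vanishes only if each of them
  -- does; there are fewer than `M` of them, each below `M`.
  have hle : coverTest I q (2 ^ n) k (m + 1) ≤ M * M := by
    refine (Finset.sum_le_card_nsmul _ _ M fun b hb => ?_).trans ?_
    · rw [Finset.mem_Ico] at hb
      exact ((Nat.mod_lt _ (by omega)).trans (by omega : b < M)).le
    · rw [Nat.card_Ico, smul_eq_mul]
      exact Nat.mul_le_mul_right _ (by omega)
  refine Ends.seq (Q := fun τ => τ.mem = σ.mem ∧ (∀ r < 10, τ.reg r = σ.reg r) ∧
    τ.reg 10 = m - 2 ∧ τ.reg 11 = 0 ∧ τ.reg 12 = 0) (Ends.block ?_) ?_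
  · simp only [wp, Store.reg_set, Store.mem_set, hc.two, h8, reduceIte, Nat.reduceEqDiff, and_true,
      true_and]
    generalize 2 ^ w = W at *
    refine ⟨by omega, by omega, by omega, fun r hr => ?_⟩
    simp [show r ≠ 10 by omega, show r ≠ 11 by omega, show r ≠ 12 by omega]
  rintro τ ⟨hτ, hr, g10, g11, g12⟩
  refine Ends.seq (Q := fun ρ => ρ.mem = σ.mem ∧ (∀ r < 10, ρ.reg r = σ.reg r) ∧
    ρ.reg 12 = coverMod I q (2 ^ n) k m) ((Ends.loop (x := 0) (z := 2 ^ n) (t := 7 * n + 18)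
    (fun S ρ => ρ.mem = τ.mem ∧ (∀ r < 11, ρ.reg r = τ.reg r) ∧ ρ.reg 11 = S ∧
      ρ.reg 12 = coverMod I q S k m)
    (fun S ρ h => ⟨h.2.2.1, by rw [h.2.1 4 (by omega), hr 4 (by omega), h4]⟩)
    (fun S ρ _ hS h => ?_) (Nat.zero_le _) ⟨rfl, fun _ _ => rfl, g11, by simp [g12, coverMod]⟩).mono
    (by simp) fun ρ h => ⟨h.1.trans hτ, fun r hr' => (h.2.1 r (by omega)).trans (hr r hr'),
      h.2.2.2⟩) ?_
  · refine (ends_termCmd hw hs hI hm hmw hk hS (hc.of_eq fun r hr' => ?_) (by rwa [h.1, hτ]) ?_ ?_ ?_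
      h.2.2.1 h.2.2.2).mono le_rfl fun π hπ => ⟨hπ.1.trans h.1,
        fun r hr' => (hπ.2.1 r hr').trans (h.2.1 r hr'), hπ.2.2.1, ?_⟩
    · rw [h.2.1 r (by omega), hr r (by omega)]
    · rw [h.2.1 6 (by omega), hr 6 (by omega), h6]
    · rw [h.2.1 8 (by omega), hr 8 (by omega), h8]
    · rw [h.2.1 10 (by omega), g10]
    · rw [hπ.2.2.2, coverMod, Finset.sum_range_succ]
  rintro ρ ⟨hρ, hr', g12'⟩
  refine Ends.block ?_
  simp only [wp, Store.reg_set, Store.mem_set, hr' 1 (by omega), hr' 8 (by omega),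
    hr' 9 (by omega), hc.one, h8, h9, g12', reduceIte, Nat.reduceEqDiff, OfNat.one_ne_ofNat]
  rw [← hsum]
  generalize 2 ^ w = W at *
  refine ⟨by omega, by omega, hρ, fun r hr => ?_, trivial, rfl⟩
  rw [← hr' r (by omega)]
  simp [show r ≠ 8 by omega, show r ≠ 9 by omega]

lemma ends_testCmd {σ : Store} {k M : ℕ} (hw : n * n + 4 * 2 ^ n + 4 < 2 ^ w)
    (hs : n * n + 2 * 2 ^ n ≤ s) (hI : TableSpec n a I q) (hM : 2 ≤ M)
    (hMw : M * M < 2 ^ w)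
    (hk : k < n) (hc : Consts n σ.reg) (hT : Table n a I q (2 ^ n) σ.mem) (h4 : σ.reg 4 = 2 ^ n)
    (h5 : σ.reg 5 = M) (h6 : σ.reg 6 = k) (h7 : σ.reg 7 = coverCount I q (2 ^ n) M k) :
    Ends w s testCmd σ (M * (2 ^ n * (7 * n + 20) + 9) + 7) fun τ => τ.mem = σ.mem ∧
      (∀ r < 6, τ.reg r = σ.reg r) ∧ τ.reg 6 = k + 1 ∧
      τ.reg 7 = coverCount I q (2 ^ n) M (k + 1) := by
  rw [show M * (2 ^ n * (7 * n + 20) + 9) + 7 = 2 + ((M * (2 ^ n * (7 * n + 20) + 9) + 2) + 3) by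
    ring]
  have hn : n < 2 ^ n := n.lt_two_pow_self
  -- The truncated difference `1 - coverTest` is the indicator of `coverTest` being zero.
  have hsum : coverCount I q (2 ^ n) M (k + 1) = coverCount I q (2 ^ n) M k +
      (1 - coverTest I q (2 ^ n) k M) := Finset.sum_range_succ ..
  have hle : coverCount I q (2 ^ n) M k ≤ k := by
    refine (Finset.sum_le_card_nsmul _ _ 1 fun b _ => Nat.sub_le _ _).trans ?_
    simp
  refine Ends.seq (Q := fun τ => τ.mem = σ.mem ∧ (∀ r < 8, τ.reg r = σ.reg r) ∧
    τ.reg 8 = 2 ∧ τ.reg 9 = 0) (Ends.block ?_) ?_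
  · simp only [wp, Store.reg_set, Store.mem_set, reduceIte, Nat.reduceEqDiff, and_true, true_and]
    generalize 2 ^ w = W at *
    refine ⟨by omega, by omega, fun r hr => ?_⟩
    simp [show r ≠ 8 by omega, show r ≠ 9 by omega]
  rintro τ ⟨hτ, hr, g8, g9⟩
  refine Ends.seq (Q := fun ρ => ρ.mem = σ.mem ∧ (∀ r < 8, ρ.reg r = σ.reg r) ∧
    ρ.reg 9 = coverTest I q (2 ^ n) k M) ((Ends.loop (x := 2) (z := M)
    (t := 2 ^ n * (7 * n + 20) + 7)
    (fun m ρ => ρ.mem = σ.mem ∧ (∀ r < 8, ρ.reg r = σ.reg r) ∧ ρ.reg 8 = m ∧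
      ρ.reg 9 = coverTest I q (2 ^ n) k m)
    (fun m ρ h => ⟨h.2.2.1, by rw [h.2.1 5 (by omega), h5]⟩)
    (fun m ρ hm hmM h => ?_) hM ⟨hτ, hr, g8, by simp [g9, coverTest]⟩).mono
    (by gcongr; omega) fun ρ h => ⟨h.1, h.2.1, h.2.2.2⟩) ?_
  · refine (ends_modCmd hw hs hI hm hmM hMw hk.le (hc.of_eq fun r hr' => ?_) (by rwa [h.1]) ?_ ?_
      h.2.2.1 h.2.2.2).mono le_rfl fun π hπ => ⟨hπ.1.trans h.1,
        fun r hr' => (hπ.2.1 r hr').trans (h.2.1 r hr'), hπ.2.2⟩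
    · rw [h.2.1 r (by omega)]
    · rw [h.2.1 4 (by omega), h4]
    · rw [h.2.1 6 (by omega), h6]
  rintro ρ ⟨hρ, hr', g9'⟩
  refine Ends.block ?_
  simp only [wp, Store.reg_set, Store.mem_set, hr' 1 (by omega), hr' 6 (by omega),
    hr' 7 (by omega), hc.one, h6, h7, g9', reduceIte, Nat.reduceEqDiff, OfNat.one_ne_ofNat]
  rw [← hsum]
  generalize 2 ^ w = W at *
  refine ⟨by omega, by omega, by omega, hρ, fun r hr => ?_, trivial, rfl⟩
  rw [← hr' r (by omega)]
  simp [show r ≠ 6 by omega, show r ≠ 7 by omega, show r ≠ 9 by omega]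

lemma ends_countCmd {σ : Store} {M : ℕ} (hw : n * n + 4 * 2 ^ n + 4 < 2 ^ w)
    (hs : n * n + 2 * 2 ^ n ≤ s) (hI : TableSpec n a I q) (hM : M = 2 * (n * n) + 10)
    (hMw : M * M < 2 ^ w)
    (hc : Consts n σ.reg) (hT : Table n a I q (2 ^ n) σ.mem) (h4 : σ.reg 4 = 2 ^ n) :
    Ends w s countCmd σ (5 + (n * (M * (2 ^ n * (7 * n + 20) + 9) + 7 + 2) + 2 + 2)) fun τ =>
      τ.reg 0 = coverCount I q (2 ^ n) M n := by
  have hMM : M ≤ M * M := Nat.le_mul_self M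
  have hn : n < 2 ^ n := n.lt_two_pow_self
  have hle : coverCount I q (2 ^ n) M n ≤ n := by
    refine (Finset.sum_le_card_nsmul _ _ 1 fun b _ => Nat.sub_le _ _).trans ?_
    simp
  refine Ends.seq (Q := fun τ => τ.mem = σ.mem ∧ (∀ r < 5, τ.reg r = σ.reg r) ∧
    τ.reg 5 = M ∧ τ.reg 6 = 0 ∧ τ.reg 7 = 0) (Ends.block ?_) ?_
  · simp only [wp, Store.reg_set, Store.mem_set, hc.three, reduceIte, Nat.reduceEqDiff, and_true,
      true_and]
    generalize 2 ^ w = W at *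
    refine ⟨by omega, by omega, by omega, by omega, by omega, fun r hr => ?_, by omega⟩
    simp [show r ≠ 5 by omega, show r ≠ 6 by omega, show r ≠ 7 by omega]
  rintro τ ⟨hτ, hr, g5, g6, g7⟩
  refine Ends.seq (Ends.loop (x := 0) (z := n)
    (fun k ρ => ρ.mem = σ.mem ∧ (∀ r < 6, ρ.reg r = τ.reg r) ∧ ρ.reg 6 = k ∧
      ρ.reg 7 = coverCount I q (2 ^ n) M k)
    (fun k ρ h => ⟨h.2.2.1, by rw [h.2.1 0 (by omega), hr 0 (by omega), hc.zero]⟩)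
    (fun k ρ _ hk h => ?_) (Nat.zero_le _) ⟨hτ, fun _ _ => rfl, g6, by simp [g7, coverCount]⟩) ?_
  · refine (ends_testCmd hw hs hI (by omega) hMw hk (hc.of_eq fun r hr' => ?_) (by rwa [h.1]) ?_
      ?_ h.2.2.1 h.2.2.2).mono le_rfl fun π hπ => ⟨hπ.1.trans h.1,
        fun r hr' => (hπ.2.1 r hr').trans (h.2.1 r hr'), hπ.2.2⟩
    · rw [h.2.1 r (by omega), hr r (by omega)]
    · rw [h.2.1 4 (by omega), hr 4 (by omega), h4]
    · rw [h.2.1 5 (by omega), g5]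
  rintro ρ ⟨hρ, hr', g6', g7'⟩
  refine Ends.block ?_
  simp only [wp, Store.reg_set, g7', reduceIte, Nat.sub_self, zero_add, OfNat.ofNat_ne_zero, and_true]
  generalize 2 ^ w = W at *
  omega

end RAM

/-! ### Binary codes of vertex sets. -/

namespace RAM

open Finset

/-- Each step adds either `0` or `2 ^ u` to a number below `2 ^ u`, hence changes only digit `u`. -/
lemma testBit_mask {a : ℕ → ℕ} (ha : ∀ l, a l ≤ 1) (S u l : ℕ) :
    (mask a S u).testBit l = decide (l < u ∧ S.testBit l = true ∧ a l = 0) := by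
  induction u with
  | zero => simp [mask]
  | succ u ih =>
    rw [mask_succ]
    by_cases h : S.testBit u = true ∧ a u = 0
    · have h1 : S / 2 ^ u % 2 = 1 := by simpa [Nat.testBit_eq_decide_div_mod_eq] using h.1
      rw [h1, h.2, Nat.sub_zero, mul_one, one_mul, add_comm]
      rcases lt_trichotomy l u with hl | rfl | hl
      · rw [Nat.testBit_two_pow_add_gt hl, ih]
        simp [hl, hl.trans (Nat.lt_succ_self u)]
      · rw [Nat.testBit_two_pow_add_eq, Nat.testBit_lt_two_pow (mask_lt a S l)]
        simp [h]
      · rw [Nat.testBit_lt_two_pow]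
        · simp [show ¬ l < u + 1 by omega]
        · calc 2 ^ u + mask a S u < 2 ^ u + 2 ^ u := by have := mask_lt a S u; omega
            _ = 2 ^ (u + 1) := by ring
            _ ≤ 2 ^ l := Nat.pow_le_pow_right (by norm_num) hl
    · have h1 : S / 2 ^ u % 2 * (1 - a u) = 0 := by
        have := ha u
        simp only [Nat.testBit_eq_decide_div_mod_eq, decide_eq_true_eq, not_and] at h
        rcases Nat.mod_two_eq_zero_or_one (S / 2 ^ u) with h0 | h0
        · simp [h0]
        · have := h h0
          simp [show 1 - a u = 0 by omega]
      rw [h1, zero_mul, add_zero, ih]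
      refine decide_eq_decide.2 ⟨fun h' => ⟨by omega, h'.2⟩, fun h' => ⟨?_, h'.2⟩⟩
      rcases Nat.lt_succ_iff_lt_or_eq.1 h'.1 with hl | rfl
      · exact hl
      · exact absurd h'.2 h

/-- The set of the positions of the ones in the binary representation of `S`. -/
def bits (n S : ℕ) : Finset (Fin n) := {i | S.testBit i = true}

@[simp] lemma mem_bits {n S : ℕ} {i : Fin n} : i ∈ bits n S ↔ S.testBit i = true := by
  simp [bits]

lemma bits_two_pow_add {n S : ℕ} (v : Fin n) (hS : S < 2 ^ (v : ℕ)) :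
    bits n (2 ^ (v : ℕ) + S) = insert v (bits n S) := by
  ext i
  rw [mem_insert, mem_bits, mem_bits]
  rcases lt_trichotomy (i : ℕ) v with h | h | h
  · rw [Nat.testBit_two_pow_add_gt h]
    simp [Fin.ext_iff, h.ne]
  · rw [h, Nat.testBit_two_pow_add_eq, Nat.testBit_lt_two_pow hS]
    simp [Fin.ext_iff, h]
  · rw [Nat.testBit_lt_two_pow, Nat.testBit_lt_two_pow]
    · simp [Fin.ext_iff, h.ne']
    · exact hS.trans (Nat.pow_lt_pow_right (by norm_num) h)
    · calc 2 ^ (v : ℕ) + S < 2 ^ (v : ℕ) + 2 ^ (v : ℕ) := by omega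
        _ = 2 ^ ((v : ℕ) + 1) := by ring
        _ ≤ 2 ^ (i : ℕ) := Nat.pow_le_pow_right (by norm_num) h

lemma notMem_bits {n S : ℕ} (v : Fin n) (hS : S < 2 ^ (v : ℕ)) : v ∉ bits n S := by
  simp [Nat.testBit_lt_two_pow hS]

lemma bits_zero (n : ℕ) : bits n 0 = ∅ := by ext; simp

lemma injOn_bits (n : ℕ) : Set.InjOn (bits n) (range (2 ^ n)) := by
  intro S hS T hT h
  simp only [coe_range, Set.mem_Iio] at hS hT
  refine Nat.eq_of_testBit_eq fun i => ?_
  rcases lt_or_ge i n with hi | hi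
  · have := congrArg (⟨i, hi⟩ ∈ ·) h
    simpa only [mem_bits, eq_iff_iff, Bool.coe_iff_coe] using this
  · have : 2 ^ n ≤ 2 ^ i := Nat.pow_le_pow_right (by norm_num) hi
    rw [Nat.testBit_lt_two_pow (hS.trans_le this), Nat.testBit_lt_two_pow (hT.trans_le this)]

lemma sum_range_bits {M : Type*} [AddCommMonoid M] (n : ℕ) (f : Finset (Fin n) → M) :
    ∑ S ∈ range (2 ^ n), f (bits n S) = ∑ A, f A := by
  have h : (range (2 ^ n)).image (bits n) = univ := by
    refine eq_univ_of_card _ ?_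
    rw [card_image_of_injOn (injOn_bits n)]
    simp
  rw [← h, sum_image (injOn_bits n)]

/-! ### Independent sets, inclusion–exclusion and colorings. -/

section Graph

variable {n : ℕ} (G : SimpleGraph (Fin n))

open Classical in
/-- The entry of the adjacency matrix. -/
noncomputable def adjEntry (i j : ℕ) : ℕ :=
  if ∃ u v : Fin n, (u : ℕ) = i ∧ (v : ℕ) = j ∧ G.Adj u v then 1 else 0

open Classical in
/-- The number of independent subsets of `A`. -/
noncomputable def indepCount (A : Finset (Fin n)) : ℕ :=
  #(A.powerset.filter fun I : Finset (Fin n) => G.IsIndepSet (I : Set (Fin n)))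

open Classical in
/-- The `k`-tuples of independent sets that cover the graph. -/
noncomputable def covers (k : ℕ) : Finset (Fin k → Finset (Fin n)) :=
  {f | (∀ i, G.IsIndepSet (f i : Set (Fin n))) ∧ univ.biUnion f = univ}

lemma adjEntry_le (i j : ℕ) : adjEntry G i j ≤ 1 := by
  unfold adjEntry; split_ifs <;> simp

lemma adjEntry_eq_zero (u v : Fin n) : adjEntry G u v = 0 ↔ ¬ G.Adj u v := by
  simp [adjEntry, ← Fin.ext_iff]

lemma indepCount_empty : indepCount G ∅ = 1 := by
  simp [indepCount, filter_singleton]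

lemma indepCount_le (A : Finset (Fin n)) : indepCount G A ≤ 2 ^ n := by
  classical
  refine (card_filter_le _ _).trans ?_
  rw [card_powerset]
  exact Nat.pow_le_pow_right (by norm_num) (by simpa using card_le_univ A)

open Classical in
-- Independent subsets either avoid `v`, or arise by adding `v` to an independent set of
-- non-neighbours of `v` in `A`.
lemma indepCount_insert {v : Fin n} {A : Finset (Fin n)} (hv : v ∉ A) :
    indepCount G (insert v A) = indepCount G A + indepCount G {u ∈ A | ¬ G.Adj v u} := by
  rw [indepCount, powerset_insert, filter_union, card_union_of_disjoint, indepCount]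
  · congr 1
    rw [filter_image, card_image_of_injOn, indepCount]
    · congr 1
      ext I
      simp only [mem_filter, mem_powerset, coe_insert, SimpleGraph.IsIndepSet,
        Set.pairwise_insert, subset_iff]
      refine ⟨fun ⟨h1, h2, h3⟩ => ⟨fun x hx => ⟨h1 hx, ?_⟩, h2⟩,
        fun ⟨h1, h2⟩ => ⟨fun x hx => (h1 hx).1, h2, fun x hx _ =>
          ⟨(h1 hx).2, fun h => (h1 hx).2 h.symm⟩⟩⟩
      exact (h3 x hx fun h => hv (h ▸ h1 hx)).1
    · intro I hI J hJ h
      simp only [coe_filter, mem_powerset, Set.mem_ofPred_eq] at hI hJ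
      rw [← erase_insert (fun h => hv (hI.1 h)), h, erase_insert (fun h => hv (hJ.1 h))]
  · rw [disjoint_left]
    intro I hI hJ
    simp only [mem_filter, mem_powerset, mem_image] at hI hJ
    obtain ⟨⟨J, -, rfl⟩, -⟩ := hJ
    exact hv (hI.1 (mem_insert_self v J))

lemma tableSpec :
    TableSpec n (adjEntry G) (fun S => indepCount G (bits n S)) (fun S => #(bits n S) % 2) where
  matrix_le := adjEntry_le G
  fst_zero := by rw [bits_zero, indepCount_empty]
  fst_add v hv S hS := by
    classical
    rw [bits_two_pow_add ⟨v, hv⟩ hS, indepCount_insert G (notMem_bits ⟨v, hv⟩ hS)]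
    congr 2
    ext u
    rw [mem_filter, mem_bits, mem_bits, testBit_mask (adjEntry_le G v), decide_eq_true_eq,
      adjEntry_eq_zero G ⟨v, hv⟩ u]
    refine ⟨fun h => ⟨?_, h⟩, fun h => h.2⟩
    by_contra h'
    rw [Nat.testBit_lt_two_pow (hS.trans_le (Nat.pow_le_pow_right (by norm_num) (by omega)))] at h
    exact absurd h.1 (by simp)
  fst_le S _ := indepCount_le G _
  snd_zero := by simp [bits_zero]
  snd_add v hv S hS := by
    rw [bits_two_pow_add ⟨v, hv⟩ hS, card_insert_of_notMem (notMem_bits ⟨v, hv⟩ hS)]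
    omega
  snd_le S := by omega

/-- Taking complements gives an alternating sum over the subsets of `Uᶜ`, which vanishes unless `Uᶜ`
is empty. -/
lemma sum_superset_neg_one_pow_card (U : Finset (Fin n)) :
    ∑ A : Finset (Fin n), (if U ⊆ A then (-1 : ℤ) ^ #A else 0) =
      if U = univ then (-1) ^ n else 0 := by
  have h : ∀ A : Finset (Fin n), (-1 : ℤ) ^ #A = (-1) ^ n * (-1) ^ #Aᶜ := by
    intro A
    have h1 : #A + #Aᶜ = n := by rw [card_add_card_compl, Fintype.card_fin]
    nth_rw 2 [← h1]
    rw [pow_add, mul_assoc, ← mul_pow]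
    simp
  calc ∑ A : Finset (Fin n), (if U ⊆ A then (-1 : ℤ) ^ #A else 0)
      = ∑ B : Finset (Fin n), (if B ⊆ Uᶜ then (-1 : ℤ) ^ n * (-1) ^ #B else 0) := by
        refine Fintype.sum_equiv (compl_involutive.toPerm _) _ _ fun A => ?_
        simp only [Function.Involutive.coe_toPerm, compl_subset_compl, h A]
    _ = (-1) ^ n * ∑ B ∈ Uᶜ.powerset, (-1) ^ #B := by
        rw [← sum_filter, mul_sum]
        refine sum_congr ?_ fun _ _ => rfl
        ext; simp
    _ = _ := by
        rw [sum_powerset_neg_one_pow_card]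
        simp [compl_eq_empty_iff]

/-- Expand the power as a count of tuples and exchange the sums: a tuple with union `U` contributes
the signed sum over all `A ⊇ U`. -/
lemma sum_indepCount_pow (k : ℕ) :
    ∑ A : Finset (Fin n), (-1 : ℤ) ^ #A * (indepCount G A : ℤ) ^ k = (-1) ^ n * #(covers G k) := by
  classical
  have h (A : Finset (Fin n)) : (indepCount G A : ℤ) ^ k = ∑ f : Fin k → Finset (Fin n),
      if ∀ i, G.IsIndepSet (f i : Set (Fin n)) then if univ.biUnion f ⊆ A then 1 else 0 else 0 := by
    have h1 : indepCount G A ^ k = #(Fintype.piFinset fun _ : Fin k =>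
        A.powerset.filter fun I : Finset (Fin n) => G.IsIndepSet (I : Set (Fin n))) := by
      rw [Fintype.card_piFinset]; simp [indepCount]
    rw [← Nat.cast_pow, h1, ← sum_filter, ← sum_filter, sum_const, nsmul_one, filter_filter]
    congr 2
    ext f
    simp [Fintype.mem_piFinset, forall_and, and_comm]
  simp_rw [h, mul_sum]
  rw [sum_comm]
  have h2 (f : Fin k → Finset (Fin n)) :
      ∑ A : Finset (Fin n), (-1 : ℤ) ^ #A * (if ∀ i, G.IsIndepSet (f i : Set (Fin n)) then
        if univ.biUnion f ⊆ A then 1 else 0 else 0) =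
      if (∀ i, G.IsIndepSet (f i : Set (Fin n))) ∧ univ.biUnion f = univ then (-1) ^ n else 0 := by
    by_cases hf : ∀ i, G.IsIndepSet (f i : Set (Fin n))
    · simp only [hf, implies_true, if_true, true_and, mul_ite, mul_one, mul_zero]
      exact sum_superset_neg_one_pow_card _
    · simp [hf]
  rw [sum_congr rfl fun f _ => h2 f, ← sum_filter, sum_const, nsmul_eq_mul, mul_comm]
  rfl

/-- The sets of a cover may overlap: any choice of a set containing each vertex is a proper
coloring. Conversely, color classes form a cover. -/
lemma covers_nonempty_iff (k : ℕ) : (covers G k).Nonempty ↔ G.Colorable k := by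
  classical
  constructor
  · rintro ⟨f, hf⟩
    simp only [covers, mem_filter, mem_univ, true_and] at hf
    have h (v : Fin n) : ∃ i, v ∈ f i := by
      have := mem_univ v
      rw [← hf.2] at this
      simpa using this
    choose c hc using h
    exact ⟨SimpleGraph.Coloring.mk c fun {u v} huv h =>
      hf.1 (c u) (hc u) (h ▸ hc v) huv.ne huv⟩
  · rintro ⟨c⟩
    refine ⟨fun i => {v | c v = i}, ?_⟩
    simp only [covers, mem_filter, mem_univ, true_and]
    refine ⟨fun i u hu v hv _ huv => c.valid huv ?_, ?_⟩
    · simp only [coe_filter, mem_univ, true_and, Set.mem_ofPred_eq] at hu hv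
      rw [hu, hv]
    · ext v; simp

lemma card_covers_le {k : ℕ} (hk : k ≤ n) : #(covers G k) ≤ 2 ^ (n * n) := by
  refine (card_le_univ _).trans ?_
  rw [Fintype.card_fun, Fintype.card_finset, Fintype.card_fin, Fintype.card_fin, ← pow_mul]
  exact Nat.pow_le_pow_right (by norm_num) (Nat.mul_le_mul_left n hk)

/-- Modulo `m` the computed sum is the signed one, and the remaining global sign is a unit. -/
lemma coverMod_eq_zero {k m : ℕ} (hm : 2 ≤ m) :
    coverMod (fun S => indepCount G (bits n S)) (fun S => #(bits n S) % 2) (2 ^ n) k m = 0 ↔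
      m ∣ #(covers G k) := by
  rw [coverMod, ← Nat.dvd_iff_mod_eq_zero, ← Int.natCast_dvd_natCast, ← Int.natCast_dvd_natCast]
  have h : ((∑ S ∈ range (2 ^ n), (1 + #(bits n S) % 2 * (m - 2)) * indepCount G (bits n S) ^ k : ℕ) :
      ℤ) ≡ (-1) ^ n * #(covers G k) [ZMOD m] := by
    rw [← sum_indepCount_pow, ← sum_range_bits, Nat.cast_sum]
    refine Int.ModEq.sum fun S _ => ?_
    rw [Nat.cast_mul, Nat.cast_pow]
    refine Int.ModEq.mul_right _ ?_
    rcases Nat.even_or_odd #(bits n S) with he | ho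
    · rw [Nat.even_iff.1 he, he.neg_one_pow]; simp
    · rw [Nat.odd_iff.1 ho, ho.neg_one_pow, one_mul, Int.modEq_iff_dvd]
      exact ⟨-1, by push_cast [Nat.cast_sub hm]; ring⟩
  rw [h.dvd_iff, IsUnit.dvd_mul_left (isUnit_one.neg.pow n)]

/-- Every prime power exactly dividing `Nat.centralBinom b` is at most `2 * b`, hence divides `N`.
If `N ≠ 0`, then `4 ^ b < b * Nat.centralBinom b ≤ 2 ^ b * 2 ^ b` is a contradiction. No primes need
to be found by the program. -/
lemma eq_zero_of_forall_dvd {N b M : ℕ} (hN : N ≤ 2 ^ b) (hb : 4 ≤ b) (hM : 2 * b < M)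
    (h : ∀ m, 2 ≤ m → m < M → m ∣ N) : N = 0 := by
  by_contra hN0
  have hd : Nat.centralBinom b ∣ N := by
    refine (Nat.factorization_prime_le_iff_dvd (Nat.centralBinom_ne_zero b) hN0).1 fun p hp => ?_
    rw [← hp.pow_dvd_iff_le_factorization hN0]
    have h1 : p ^ (Nat.centralBinom b).factorization p ≤ 2 * b :=
      Nat.pow_factorization_choose_le (by omega)
    rcases Nat.lt_or_ge (p ^ (Nat.centralBinom b).factorization p) 2 with h2 | h2
    · have : 0 < p ^ (Nat.centralBinom b).factorization p := pow_pos hp.pos _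
      rw [show p ^ (Nat.centralBinom b).factorization p = 1 by omega]
      exact one_dvd N
    · exact h _ h2 (by omega)
  have h1 := (Nat.le_of_dvd (Nat.pos_of_ne_zero hN0) hd).trans hN
  have h2 := Nat.four_pow_lt_mul_centralBinom b hb
  have h3 : b < 2 ^ b := b.lt_two_pow_self
  have h4 : b * Nat.centralBinom b ≤ 2 ^ b * 2 ^ b := Nat.mul_le_mul h3.le h1
  rw [← mul_pow] at h4
  norm_num at h4
  omega

lemma coverTest_eq_zero {k : ℕ} (hk : k ≤ n) :
    coverTest (fun S => indepCount G (bits n S)) (fun S => #(bits n S) % 2) (2 ^ n) k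
      (2 * (n * n) + 10) = 0 ↔ ¬ G.Colorable k := by
  rw [coverTest, sum_eq_zero_iff, ← covers_nonempty_iff, not_nonempty_iff_eq_empty, ← card_eq_zero]
  constructor
  · intro h
    -- The summand `4` ensures `4 ≤ b` for small `n` too; then `2 * b = 2 * (n * n) + 8` is below
    -- the limit for the moduli.
    refine eq_zero_of_forall_dvd (b := n * n + 4) ((card_covers_le G hk).trans
      (Nat.pow_le_pow_right (by norm_num) (by omega))) (by omega)
      (show _ < 2 * (n * n) + 10 by omega) fun m h1 h2 => ?_
    exact (coverMod_eq_zero G h1).1 (h m (mem_Ico.2 ⟨h1, h2⟩))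
  · intro h m hm
    rw [coverMod_eq_zero G (mem_Ico.1 hm).1, h]
    exact dvd_zero m

/-- The `k` without a `k`-coloring are exactly those below the chromatic number, and all of them are
below `n` because `n` colors suffice. -/
lemma coverCount_eq :
    (coverCount (fun S => indepCount G (bits n S)) (fun S => #(bits n S) % 2) (2 ^ n)
      (2 * (n * n) + 10) n : ℕ∞) = G.chromaticNumber := by
  have hn : G.Colorable n := by simpa using G.colorable_of_fintype
  obtain ⟨χ, hχ⟩ := ENat.ne_top_iff_exists.1 (SimpleGraph.chromaticNumber_ne_top_iff_exists.2 ⟨n, hn⟩)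
  have hc (k : ℕ) : G.Colorable k ↔ χ ≤ k := by
    rw [← SimpleGraph.chromaticNumber_le_iff_colorable, ← hχ, Nat.cast_le]
  rw [← hχ, Nat.cast_inj]
  calc coverCount _ _ _ _ n = ∑ k ∈ range n, if k < χ then 1 else 0 := by
        refine sum_congr rfl fun k hk => ?_
        have := coverTest_eq_zero G (mem_range.1 hk).le
        rw [hc, not_le] at this
        split_ifs with h
        · rw [this.2 h]
        · have := mt this.1 h
          omega
    _ = #(range χ) := by
        rw [← card_filter]
        congr 1
        ext k
        have := (hc n).1 hn
        simp only [mem_filter, mem_range]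
        omega
    _ = χ := card_range χ

end Graph

end RAM

/-! ### Numerical bounds and the complete program. -/

namespace RAM

/-- The structured program for the chromatic number. -/
def chromaticCmd : Cmd := .seq tableCmd countCmd

lemma sq_le_two_mul_two_pow (n : ℕ) : n * n ≤ 2 * 2 ^ n := by
  rcases lt_or_ge n 4 with h | h
  · interval_cases n <;> norm_num
  · induction n, h using Nat.le_induction with
    | base => norm_num
    | succ n hn ih => rw [pow_succ]; nlinarith

/-- Needed for the word size: the square of the limit for the moduli is of order `n ^ 4` and has to
fit into `n + 10` bits. -/
lemma pow_four_le_mul_two_pow (n : ℕ) : n ^ 4 ≤ 32 * 2 ^ n := by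
  rcases lt_or_ge n 6 with h | h
  · interval_cases n <;> norm_num
  · induction n, h using Nat.le_induction with
    | base => norm_num
    | succ n hn ih =>
      have h1 : 6 * n ^ 3 ≤ n * n ^ 3 := Nat.mul_le_mul_right _ hn
      have h2 : 6 * n ^ 2 ≤ n * n ^ 2 := Nat.mul_le_mul_right _ hn
      have h3 : 6 * n ≤ n * n := Nat.mul_le_mul_right _ hn
      have h4 : (n + 1) ^ 4 ≤ 2 * n ^ 4 := by ring_nf at *; omega
      rw [pow_succ 2]; omega

lemma running_time_le (n : ℕ) :
    9 + (n * (2 ^ n * (14 * n + 25) + 6 + 2) + 2) +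
      (5 + (n * ((2 * (n * n) + 10) * (2 ^ n * (7 * n + 20) + 9) + 7 + 2) + 2 + 2)) ≤
      500 * ((n + 1) ^ 4 * 2 ^ n) := by
  have hX := Nat.one_le_two_pow (n := n)
  generalize 2 ^ n = X at *
  have h1 : 9 + (n * (X * (14 * n + 25) + 6 + 2) + 2) ≤
      X * (9 + (n * (14 * n + 25 + 6 + 2) + 2)) := by
    calc _ ≤ X * 9 + (n * (X * (14 * n + 25) + X * 6 + X * 2) + X * 2) := by gcongr <;> omega
      _ = _ := by ring
  have h2 : 5 + (n * ((2 * (n * n) + 10) * (X * (7 * n + 20) + 9) + 7 + 2) + 2 + 2) ≤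
      X * (5 + (n * ((2 * (n * n) + 10) * (7 * n + 20 + 9) + 7 + 2) + 2 + 2)) := by
    calc _ ≤ X * 5 + (n * ((2 * (n * n) + 10) * (X * (7 * n + 20) + X * 9) + X * 7 + X * 2) +
          X * 2 + X * 2) := by gcongr <;> omega
      _ = _ := by ring
  have h3 : 9 + (n * (14 * n + 25 + 6 + 2) + 2) +
      (5 + (n * ((2 * (n * n) + 10) * (7 * n + 20 + 9) + 7 + 2) + 2 + 2)) ≤
        500 * (n + 1) ^ 4 := by
    ring_nf; omega
  calc _ ≤ X * _ + X * _ := add_le_add h1 h2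
    _ = X * _ := (mul_add ..).symm
    _ ≤ X * (500 * (n + 1) ^ 4) := Nat.mul_le_mul_left X h3
    _ = _ := by ring

lemma exists_pow_four_mul_two_pow_le {β : ℝ} (hβ : 2.4 ≤ β) :
    ∃ B : ℝ, 0 ≤ B ∧ ∀ n : ℕ, ((n : ℝ) + 1) ^ 4 * 2 ^ n ≤ B * β ^ n := by
  -- Here `5 / 6 = 2 / 2.4`; the shift from `n` to `n + 1` costs the factor `6 / 5` below.
  obtain ⟨B, hB⟩ := (tendsto_pow_const_mul_const_pow_of_abs_lt_one 4
    (show |(5 / 6 : ℝ)| < 1 by rw [abs_of_pos] <;> norm_num)).bddAbove_range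
  have hB' (n : ℕ) : (n : ℝ) ^ 4 * (5 / 6) ^ n ≤ B := hB ⟨n, rfl⟩
  have hB0 : 0 ≤ B := le_trans (by positivity) (hB' 0)
  refine ⟨6 / 5 * B, by positivity, fun n => ?_⟩
  have h := hB' (n + 1)
  calc ((n : ℝ) + 1) ^ 4 * 2 ^ n
      = 6 / 5 * (((n + 1 : ℕ) : ℝ) ^ 4 * (5 / 6) ^ (n + 1)) * 2.4 ^ n := by
        rw [show (2 : ℝ) = 5 / 6 * 2.4 by norm_num, mul_pow]; push_cast; ring
    _ ≤ 6 / 5 * B * β ^ n := by gcongr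

lemma three_rpow_bounds :
    4.326467 < (3 : ℝ) ^ (4 / 3 : ℝ) ∧ (3 : ℝ) ^ (4 / 3 : ℝ) < 4.3268 := by
  have h : ((3 : ℝ) ^ (4 / 3 : ℝ)) ^ 3 = 81 := by
    rw [← Real.rpow_natCast, ← Real.rpow_mul (by norm_num)]
    norm_num
  have h0 : 0 ≤ (3 : ℝ) ^ (4 / 3 : ℝ) := by positivity
  exact ⟨lt_of_pow_lt_pow_left₀ 3 h0 (by rw [h]; norm_num),
    lt_of_pow_lt_pow_left₀ 3 (by norm_num) (by rw [h]; norm_num)⟩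

lemma init_mem {n : ℕ} (G : SimpleGraph (Fin n)) {i j : ℕ} (hi : i < n) (hj : j < n) :
    (init G).mem (n * i + j) = adjEntry G i j := by
  classical
  simp only [init, adjEntry]
  refine if_congr (exists_congr fun u => exists_congr fun v => ?_) rfl rfl
  constructor
  · rintro ⟨h, h'⟩
    have h1 := congrArg (· / n) h
    have h2 := congrArg (· % n) h
    simp only [Nat.mul_add_div (by omega : n > 0), Nat.mul_add_mod, Nat.div_eq_of_lt hj,
      Nat.div_eq_of_lt v.2, Nat.mod_eq_of_lt hj, Nat.mod_eq_of_lt v.2] at h1 h2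
    exact ⟨by omega, h2.symm, h'⟩
  · rintro ⟨rfl, rfl, h⟩
    exact ⟨rfl, h⟩

lemma ends_chromaticCmd {n s : ℕ} (G : SimpleGraph (Fin n)) (hs : n * n + 2 * 2 ^ n ≤ s) :
    Ends (n + 10) s chromaticCmd ⟨(init G).reg, (init G).mem⟩ (500 * ((n + 1) ^ 4 * 2 ^ n))
      fun τ => (τ.reg 0 : ℕ∞) = G.chromaticNumber := by
  have h2 := sq_le_two_mul_two_pow n
  have h4 := pow_four_le_mul_two_pow n
  have hX := Nat.one_le_two_pow (n := n)
  have hw : n * n + 4 * 2 ^ n + 4 < 2 ^ (n + 10) := by rw [pow_add]; omega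
  have hM : (2 * (n * n) + 10) * (2 * (n * n) + 10) < 2 ^ (n + 10) := by
    rw [pow_add, show (2 * (n * n) + 10) * (2 * (n * n) + 10) = 4 * n ^ 4 + 40 * (n * n) + 100 by
      ring]
    omega
  refine (Ends.seq (ends_tableCmd hw hs (tableSpec G) rfl fun i hi j hj => init_mem G hi hj)
    fun τ h => ends_countCmd hw hs (tableSpec G) rfl hM h.2.1 h.1 h.2.2).mono (running_time_le n)
    fun τ h => ?_
  rw [h, coverCount_eq]

end RAM

theorem theorem3 :
    (∃ (P : RAM.Program) (c C : ℕ), ∀ (n : ℕ) (G : SimpleGraph (Fin n)),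
      ∃ (t : ℕ) (final : RAM.Config),
        RAM.Steps P (n + c) (C * 2 ^ n) t (RAM.init G) final ∧
        RAM.Halted P final ∧
        ((final.reg 0 : ℕ) : ℕ∞) = G.chromaticNumber ∧
        (t : ℝ) ≤ (C : ℝ) * (4 / 3 + (3 : ℝ) ^ (4 / 3 : ℝ) / 4) ^ n) ∧
    |(4 / 3 + (3 : ℝ) ^ (4 / 3 : ℝ) / 4) - 2.4150| < 0.00005 := by
  obtain ⟨h1, h2⟩ := RAM.three_rpow_bounds
  refine ⟨?_, by rw [abs_lt]; constructor <;> linarith⟩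
  have hβ : (2.4 : ℝ) ≤ 4 / 3 + (3 : ℝ) ^ (4 / 3 : ℝ) / 4 := by linarith
  generalize (4 / 3 + (3 : ℝ) ^ (4 / 3 : ℝ) / 4) = β at hβ
  obtain ⟨B, hB0, hB⟩ := RAM.exists_pow_four_mul_two_pow_le hβ
  -- The `4` pays for the memory, `n * n ≤ 2 * 2 ^ n` cells of matrix and `2 * 2 ^ n` of table; `500
  -- * B` pays for the time.
  refine ⟨RAM.chromaticCmd.code 0, 10, max 4 ⌈500 * B⌉₊, fun n G => ?_⟩
  have hs : n * n + 2 * 2 ^ n ≤ max 4 ⌈500 * B⌉₊ * 2 ^ n :=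
    calc n * n + 2 * 2 ^ n ≤ 4 * 2 ^ n := by have := RAM.sq_le_two_mul_two_pow n; omega
      _ ≤ _ := Nat.mul_le_mul_right _ (le_max_left _ _)
  obtain ⟨t, ht, τ, hτ, h⟩ := RAM.ends_chromaticCmd G hs
  refine ⟨t, τ.at (0 + RAM.chromaticCmd.len), hτ.steps _ 0 fun k _ => by rw [zero_add], ?_, h, ?_⟩
  · simp [RAM.Halted, RAM.Store.at, RAM.Cmd.length_code]
  · calc (t : ℝ) ≤ 500 * (((n : ℝ) + 1) ^ 4 * 2 ^ n) := by exact_mod_cast ht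
      _ ≤ 500 * (B * β ^ n) := mul_le_mul_of_nonneg_left (hB n) (by norm_num)
      _ = 500 * B * β ^ n := by ring
      _ ≤ _ := by
        have : 500 * B ≤ (max 4 ⌈500 * B⌉₊ : ℕ) :=
          (Nat.le_ceil _).trans (Nat.cast_le.2 (le_max_right _ _))
        gcongr
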